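/- Let $n\in\mathbb N$, let $\rho$ be an arbitrary fixed $n$-qubit state (a density matrix on $(\mathbb C^2)^{\otimes n}$, pure or mixed), and let $x\in\{0,1\}^n$. Let $U$ be a uniformly random $n$-qubit Clifford unitary, that is, a uniformly random element of the finite group of unitaries in $U(2^n)$ that normalize the $n$-qubit Pauli group $\{i^kP_1\otimes\cdots\otimes P_n: k\in\mathbb Z,\ P_j\in\{\mathbb 1,X,Y,Z\}\}$, taken modulo global phases. Let $$p_x:=\operatorname{tr}\left(U\rho U^\dagger|x\rangle\langle x|\right)$$ be the Born rule probability of the outcome $x$ when all qubits of $U\rho U^\dagger$ are measured in the computational basis. Then for every $\alpha\in(0,1)$, $$\Pr_U\left(p_x\ge\frac{\alpha}{2^n}\right)>\frac{(1-\alpha)^2}{2}.$$ -/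

import Mathlib

open Matrix
open scoped ComplexOrder

noncomputable section

namespace QClifford

/-- The set of bit strings `{0,1}ⁿ`, labelling the computational basis of `n` qubits. -/
abbrev BitString (n : ℕ) : Type := Fin n → Fin 2

/-- The group `U(2ⁿ)` of unitary operators on `n` qubits, written in the computational basis. -/
abbrev NQubitUnitary (n : ℕ) : Type := Matrix.unitaryGroup (BitString n) ℂ

/-- The single-qubit Pauli matrices `1, X, Y, Z`. -/
def pauli : Fin 4 → Matrix (Fin 2) (Fin 2) ℂ :=
  ![1, !![0, 1; 1, 0], !![0, -Complex.I; Complex.I, 0], !![1, 0; 0, -1]]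

/-- The tensor product `P₁ ⊗ ⋯ ⊗ Pₙ` of the single-qubit Pauli matrices chosen by `s`. -/
def pauliString {n : ℕ} (s : Fin n → Fin 4) : Matrix (BitString n) (BitString n) ℂ :=
  Matrix.of fun x y => ∏ i, pauli (s i) (x i) (y i)

theorem pauli_mul (a b : Fin 4) :
    ∃ (k : ℕ) (c : Fin 4), pauli a * pauli b = Complex.I ^ k • pauli c := by
  have h3 : Complex.I ^ 3 = -Complex.I := Complex.I_pow_three
  fin_cases a <;> fin_cases b
  · exact ⟨0, 0, by simp [pauli]⟩
  · exact ⟨0, 1, by simp [pauli]⟩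
  · exact ⟨0, 2, by simp [pauli]⟩
  · exact ⟨0, 3, by simp [pauli]⟩
  · exact ⟨0, 1, by simp [pauli]⟩
  · exact ⟨0, 0, by simp [pauli, Matrix.one_fin_two]⟩
  · exact ⟨1, 3, by simp [pauli]⟩
  · exact ⟨3, 2, by simp [pauli, h3]⟩
  · exact ⟨0, 2, by simp [pauli]⟩
  · exact ⟨3, 3, by simp [pauli, h3]⟩
  · exact ⟨0, 0, by simp [pauli, Matrix.one_fin_two]⟩
  · exact ⟨1, 1, by simp [pauli]⟩
  · exact ⟨0, 3, by simp [pauli]⟩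
  · exact ⟨1, 2, by simp [pauli]⟩
  · exact ⟨3, 1, by simp [pauli, h3]⟩
  · exact ⟨0, 0, by simp [pauli, Matrix.one_fin_two]⟩

theorem pauli_conjTranspose (a : Fin 4) : (pauli a)ᴴ = pauli a := by
  fin_cases a <;> ext i j <;> fin_cases i <;> fin_cases j <;>
    simp [pauli, Matrix.conjTranspose_apply]

theorem pauliString_zero {n : ℕ} : pauliString (fun _ : Fin n => 0) = 1 := by
  ext x y
  simp only [pauliString, pauli, Matrix.of_apply, Matrix.cons_val_zero, Matrix.one_apply]
  rw [Finset.prod_ite_zero]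
  simp [funext_iff]

theorem pauliString_mul {n : ℕ} (s t : Fin n → Fin 4) :
    ∃ (k : ℕ) (u : Fin n → Fin 4),
      pauliString s * pauliString t = Complex.I ^ k • pauliString u := by
  choose k c hkc using fun i => pauli_mul (s i) (t i)
  refine ⟨∑ i, k i, c, ?_⟩
  ext x y
  have h : ∀ i, ∑ z, pauli (s i) (x i) z * pauli (t i) z (y i)
      = Complex.I ^ k i * pauli (c i) (x i) (y i) := by
    intro i
    have := congrFun (congrFun (hkc i) (x i)) (y i)
    simpa [Matrix.mul_apply] using this
  simp only [pauliString, Matrix.mul_apply, Matrix.of_apply, Matrix.smul_apply, smul_eq_mul]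
  rw [← Finset.prod_pow_eq_pow_sum, ← Finset.prod_mul_distrib]
  simp_rw [← h, ← Finset.prod_mul_distrib]
  rw [Finset.prod_univ_sum]
  simp

theorem pauliString_conjTranspose {n : ℕ} (s : Fin n → Fin 4) :
    (pauliString s)ᴴ = pauliString s := by
  ext x y
  simp only [pauliString, Matrix.conjTranspose_apply, Matrix.of_apply, star_prod]
  refine Finset.prod_congr rfl fun i _ => ?_
  exact congrFun (congrFun (pauli_conjTranspose (s i)) (x i)) (y i)

/-- The `n`-qubit Pauli group `{iᵏ P₁ ⊗ ⋯ ⊗ Pₙ}`. -/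
def pauliGroup (n : ℕ) : Subgroup (NQubitUnitary n) where
  carrier := {U | ∃ (k : ℕ) (s : Fin n → Fin 4),
    (U : Matrix (BitString n) (BitString n) ℂ) = Complex.I ^ k • pauliString s}
  one_mem' := ⟨0, fun _ => 0, by simp [pauliString_zero]⟩
  mul_mem' := by
    rintro U V ⟨k, s, hU⟩ ⟨l, t, hV⟩
    obtain ⟨m, u, hu⟩ := pauliString_mul s t
    refine ⟨k + l + m, u, ?_⟩
    rw [Submonoid.coe_mul, hU, hV, smul_mul_smul_comm, hu, smul_smul, pow_add, pow_add]
  inv_mem' := by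
    rintro U ⟨k, s, hU⟩
    refine ⟨3 * k, s, ?_⟩
    have h : ((U⁻¹ : NQubitUnitary n) : Matrix (BitString n) (BitString n) ℂ)
        = (U : Matrix (BitString n) (BitString n) ℂ)ᴴ := rfl
    rw [h, hU, Matrix.conjTranspose_smul, pauliString_conjTranspose, star_pow, pow_mul,
      Complex.I_pow_three]
    simp

/-- The `n`-qubit Clifford group: the unitaries that normalize the Pauli group. -/
abbrev cliffordGroup (n : ℕ) : Subgroup (NQubitUnitary n) :=
  Subgroup.normalizer (pauliGroup n : Set (NQubitUnitary n))

/-- The global phases `c · 1`. -/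
def globalPhases (n : ℕ) : Subgroup (NQubitUnitary n) where
  carrier := {U | ∃ c : ℂ, (U : Matrix (BitString n) (BitString n) ℂ) = c • 1}
  one_mem' := ⟨1, by simp⟩
  mul_mem' := by
    rintro U V ⟨c, hU⟩ ⟨d, hV⟩
    exact ⟨c * d, by rw [Submonoid.coe_mul, hU, hV, smul_mul_smul_comm, one_mul]⟩
  inv_mem' := by
    rintro U ⟨c, hU⟩
    have h : ((U⁻¹ : NQubitUnitary n) : Matrix (BitString n) (BitString n) ℂ)
        = (U : Matrix (BitString n) (BitString n) ℂ)ᴴ := rfl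
    exact ⟨star c, by rw [h, hU, Matrix.conjTranspose_smul, Matrix.conjTranspose_one]⟩

/-- The `n`-qubit Clifford unitaries, two of them being identified when they differ by a global
phase. This is a finite set. -/
abbrev CliffordUnitary (n : ℕ) : Type :=
  cliffordGroup n ⧸ (globalPhases n).subgroupOf (cliffordGroup n)

theorem pauliString_mem {n : ℕ} (s : Fin n → Fin 4) :
    pauliString s ∈ Matrix.unitaryGroup (BitString n) ℂ := by
  have hone : pauliString s * pauliString s = 1 := by
    have h2 : ∀ a : Fin 4, pauli a * pauli a = 1 := by
      intro a
      fin_cases a <;> simp [pauli, Matrix.one_fin_two]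
    ext x y
    simp only [pauliString, Matrix.mul_apply, Matrix.of_apply, ← Finset.prod_mul_distrib]
    rw [← Fintype.prod_sum fun i z => pauli (s i) (x i) z * pauli (s i) z (y i)]
    simp_rw [← Matrix.mul_apply, h2, Matrix.one_apply]
    rw [Finset.prod_ite_zero]
    simp [funext_iff]
  rw [Matrix.mem_unitaryGroup_iff, Matrix.star_eq_conjTranspose, pauliString_conjTranspose, hone]

theorem eq_smul_one_of_commute {n : ℕ} (V : Matrix (BitString n) (BitString n) ℂ)
    (h : ∀ s : Fin n → Fin 4, pauliString s * V = V * pauliString s) :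
    ∃ c : ℂ, V = c • 1 := by
  have hZ : ∀ (i : Fin n), pauliString (fun j => if j = i then (3 : Fin 4) else 0)
      = Matrix.diagonal fun x : BitString n => if x i = 0 then (1 : ℂ) else -1 := by
    intro i
    ext x y
    simp only [pauliString, Matrix.of_apply]
    by_cases hxy : x = y
    · subst hxy
      rw [Matrix.diagonal_apply_eq, Finset.prod_eq_single i]
      · rcases Fin.exists_fin_two.mp ⟨x i, rfl⟩ with hx | hx <;> simp [hx, pauli]
      · intro j _ hj
        simp [hj, pauli]
      · simp
    · rw [Matrix.diagonal_apply_ne _ hxy]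
      obtain ⟨j, hj⟩ := Function.ne_iff.mp hxy
      refine Finset.prod_eq_zero (Finset.mem_univ j) ?_
      by_cases hji : j = i
      · subst hji
        generalize x j = a at hj ⊢
        generalize y j = b at hj ⊢
        fin_cases a <;> fin_cases b <;> simp_all [pauli]
      · simp [hji, pauli, hj]
  have hoff : ∀ x y, x ≠ y → V x y = 0 := by
    intro x y hxy
    obtain ⟨j, hj⟩ := Function.ne_iff.mp hxy
    have h1 := congrFun (congrFun (h fun k => if k = j then (3 : Fin 4) else 0) x) y
    rw [hZ, Matrix.diagonal_mul, Matrix.mul_diagonal] at h1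
    generalize x j = a at hj h1
    generalize y j = b at hj h1
    fin_cases a <;> fin_cases b <;> simp at hj h1
    · linear_combination h1 / 2
    · linear_combination -h1 / 2
  have hdiag : V = Matrix.diagonal fun x => V x x := by
    ext x y
    by_cases hxy : x = y
    · subst hxy; simp
    · rw [Matrix.diagonal_apply_ne _ hxy, hoff x y hxy]
  refine ⟨V 0 0, ?_⟩
  ext x y
  by_cases hxy : x = y
  · subst hxy
    have h1 := congrFun (congrFun (h fun i => if x i = 0 then (0 : Fin 4) else 1) x) 0
    have h2 : pauliString (fun i => if x i = 0 then (0 : Fin 4) else 1) x 0 = 1 := by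
      simp only [pauliString, Matrix.of_apply]
      refine Finset.prod_eq_one fun i _ => ?_
      generalize x i = a
      fin_cases a <;> simp [pauli]
    rw [hdiag, Matrix.mul_diagonal, Matrix.diagonal_mul, h2] at h1
    simp at h1
    simp [h1]
  · simp [hoff x y hxy, hxy]

instance finite_pauliGroup (n : ℕ) : Finite (pauliGroup n) := by
  have hmem : ∀ U : pauliGroup n, ∃ p : Fin 4 × (Fin n → Fin 4),
      (U.1 : Matrix (BitString n) (BitString n) ℂ)
        = Complex.I ^ (p.1 : ℕ) • pauliString p.2 := by
    rintro ⟨U, k, s, hU⟩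
    refine ⟨(⟨k % 4, Nat.mod_lt _ (by norm_num)⟩, s), ?_⟩
    rw [hU, Complex.I_pow_eq_pow_mod]
  choose f hf using hmem
  refine Finite.of_injective f fun U V hUV => ?_
  apply Subtype.ext
  apply Subtype.ext
  rw [hf U, hf V, hUV]

/-- Conjugation determines a Clifford unitary up to a global phase, so there are finitely many. -/
instance finite_cliffordUnitary (n : ℕ) : Finite (CliffordUnitary n) := by
  let φ := Subgroup.normalizerMonoidHom (pauliGroup n)
  have hle : φ.ker ≤ (globalPhases n).subgroupOf (cliffordGroup n) := by
    intro U hU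
    rw [Subgroup.mem_subgroupOf]
    have hU' : φ U = 1 := hU
    refine eq_smul_one_of_commute _ fun s => ?_
    let P : pauliGroup n := ⟨⟨pauliString s, pauliString_mem s⟩, 0, s, by simp⟩
    have h1 : ((φ U P : pauliGroup n) : NQubitUnitary n) = P := by rw [hU']; rfl
    have h2 : (U : NQubitUnitary n) * P * (U : NQubitUnitary n)⁻¹ = P := h1
    rw [mul_inv_eq_iff_eq_mul] at h2
    exact (congrArg Subtype.val h2).symm
  have : Finite (MulAut (pauliGroup n)) :=
    Finite.of_injective (fun e : MulAut (pauliGroup n) => (e : pauliGroup n → pauliGroup n))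
      DFunLike.coe_injective
  have : φ.ker.FiniteIndex := Subgroup.finiteIndex_ker φ
  have : ((globalPhases n).subgroupOf (cliffordGroup n)).FiniteIndex :=
    Subgroup.finiteIndex_of_le hle
  exact Subgroup.finite_quotient_of_finiteIndex

/-- An `n`-qubit state: a density matrix, possibly mixed or entangled. -/
def IsState {n : ℕ} (ρ : Matrix (BitString n) (BitString n) ℂ) : Prop :=
  ρ.PosSemidef ∧ ρ.trace = 1

/-- The projector `|x⟩⟨x|` on the computational basis vector `|x⟩`. -/
def basisProjector {n : ℕ} (x : BitString n) : Matrix (BitString n) (BitString n) ℂ :=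
  Matrix.vecMulVec (Pi.single x 1) (star (Pi.single x 1))

/-- The Born rule probability `tr(U ρ U† |x⟩⟨x|)`. For a state `ρ` the trace is a nonnegative
real number, see `coe_bornProb`. -/
def bornProb {n : ℕ} (ρ : Matrix (BitString n) (BitString n) ℂ) (x : BitString n)
    (U : NQubitUnitary n) : ℝ :=
  (Matrix.trace ((U : Matrix (BitString n) (BitString n) ℂ) * ρ *
    (U : Matrix (BitString n) (BitString n) ℂ)ᴴ * basisProjector x)).re

theorem trace_mul_basisProjector {n : ℕ} (A : Matrix (BitString n) (BitString n) ℂ)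
    (x : BitString n) : Matrix.trace (A * basisProjector x) = A x x := by
  have h : star (Pi.single x (1 : ℂ) : BitString n → ℂ) = Pi.single x 1 := by
    rw [← Pi.single_star, star_one]
  rw [basisProjector, h, Matrix.mul_vecMulVec, Matrix.trace_vecMulVec, dotProduct_single, mul_one,
    Matrix.mulVec_single_one, Matrix.col_apply]

theorem coe_bornProb {n : ℕ} {ρ : Matrix (BitString n) (BitString n) ℂ} (hρ : IsState ρ)
    (x : BitString n) (U : NQubitUnitary n) :
    0 ≤ bornProb ρ x U ∧
      (bornProb ρ x U : ℂ) = Matrix.trace ((U : Matrix (BitString n) (BitString n) ℂ) * ρ *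
        (U : Matrix (BitString n) (BitString n) ℂ)ᴴ * basisProjector x) := by
  have h := (hρ.1.mul_mul_conjTranspose_same
    (U : Matrix (BitString n) (BitString n) ℂ)).diag_nonneg (i := x)
  rw [Complex.le_def] at h
  rw [bornProb, trace_mul_basisProjector]
  exact ⟨h.1, Complex.ext rfl h.2⟩

/-- The probability `p_x` of the outcome `x`, as a function of the Clifford unitary that is applied
to `ρ`; it does not see global phases. -/
def outcomeProb {n : ℕ} (ρ : Matrix (BitString n) (BitString n) ℂ) (x : BitString n) :
    CliffordUnitary n → ℝ :=
  Quotient.lift (fun U : cliffordGroup n => bornProb ρ x U.1) (by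
    intro U V hUV
    have hUV' : U⁻¹ * V ∈ (globalPhases n).subgroupOf (cliffordGroup n) :=
      QuotientGroup.leftRel_apply.mp hUV
    rw [Subgroup.mem_subgroupOf] at hUV'
    obtain ⟨c, hc⟩ := hUV'
    have hW : ((U⁻¹ * V : cliffordGroup n) : NQubitUnitary n).1 ∈
        Matrix.unitaryGroup (BitString n) ℂ := ((U⁻¹ * V : cliffordGroup n) : NQubitUnitary n).2
    rw [hc, Matrix.mem_unitaryGroup_iff, Matrix.star_eq_conjTranspose, Matrix.conjTranspose_smul,
      Matrix.conjTranspose_one, smul_mul_smul_comm, one_mul] at hW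
    have hcc : c * star c = 1 := by
      have := congrFun (congrFun hW 0) 0
      simpa using this
    have hV : (V.1 : Matrix (BitString n) (BitString n) ℂ)
        = c • (U.1 : Matrix (BitString n) (BitString n) ℂ) := by
      have h1 : V = U * (U⁻¹ * V) := by group
      have h2 : (V.1 : Matrix (BitString n) (BitString n) ℂ)
          = (U.1 : Matrix (BitString n) (BitString n) ℂ) *
            ((U⁻¹ * V : cliffordGroup n) : NQubitUnitary n).1 :=
        congrArg (fun W : cliffordGroup n => (W.1 : Matrix (BitString n) (BitString n) ℂ)) h1
      rw [h2, hc, mul_smul_comm, mul_one]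
    simp only [bornProb]
    rw [hV, Matrix.conjTranspose_smul, smul_mul_assoc, smul_mul_smul_comm, hcc, one_smul])

/-- The probability of the event `A` for a uniformly random element of a finite set `Ω`. -/
def uniformProb {Ω : Type*} [Finite Ω] [Nonempty Ω] (A : Set Ω) : ℝ :=
  (A.ncard : ℝ) / (Nat.card Ω : ℝ)

end QClifford

end

namespace QClifford

/-! The proof is a second-moment argument. Put `d = 2 ^ n` and expand `ρ` in Pauli strings, so that
`d * p_x` is the sum over `s` of `tr(P_s ρ)` times `⟨x|U P_s U†|x⟩`. Three facts determine the
moments over `U`.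

Pauli strings are Clifford, and conjugating by one multiplies each `P_s` by a sign. Distinct strings
are separated by these signs, so cross terms average to zero
(`sum_outcomeProb_pauliString_mul_of_ne`). The mean of `p_x` is therefore `1 / d`.

The Clifford group acts transitively on nonidentity strings, so all of them have the same mean
square. For each `U` the squares sum to `d` over all strings and the identity contributes `1`, which
forces the common value `(d - 1) / (d² - 1) = 1 / (d + 1)`.

Since `tr ρ² ≤ 1`, the mean of `(d * p_x)²` is at most `1 + (d - 1) / (d + 1) = 2d / (d + 1) < 2`,
and Paley–Zygmund concludes. -/

/-! ### Pauli expansion and purity -/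

theorem sum_pauli_mul_pauli (a b c e : Fin 2) :
    ∑ k, pauli k a b * pauli k c e = if a = e ∧ b = c then 2 else 0 := by
  fin_cases a <;> fin_cases b <;> fin_cases c <;> fin_cases e <;>
    simp [pauli, Fin.sum_univ_four] <;> norm_num

/-- `∑ₛ Pₛ ⊗ Pₛ` is `2ⁿ` times the swap operator. -/
theorem sum_pauliString_mul_pauliString {n : ℕ} (a b c e : BitString n) :
    ∑ s : Fin n → Fin 4, pauliString s a b * pauliString s c e
      = if a = e ∧ b = c then 2 ^ n else 0 := by
  simp only [pauliString, Matrix.of_apply, ← Finset.prod_mul_distrib]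
  rw [← Fintype.prod_sum fun i k => pauli k (a i) (b i) * pauli k (c i) (e i)]
  simp_rw [sum_pauli_mul_pauli]
  rw [Finset.prod_ite_zero]
  simp [funext_iff, forall_and]

/-- Contracting the swap identity with `A` shows that the Pauli strings span, with explicit
coefficients. -/
theorem sum_trace_pauliString_mul_apply {n : ℕ} (A : Matrix (BitString n) (BitString n) ℂ)
    (a b : BitString n) :
    ∑ s : Fin n → Fin 4, (pauliString s * A).trace * pauliString s a b = 2 ^ n * A a b := by
  simp only [Matrix.trace, Matrix.diag_apply, Matrix.mul_apply, Finset.sum_mul]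
  rw [Finset.sum_comm]
  have h : ∀ c, ∑ s : Fin n → Fin 4, ∑ e, pauliString s c e * A e c * pauliString s a b
      = ∑ e, (if c = b ∧ e = a then 2 ^ n else 0) * A e c := by
    intro c
    rw [Finset.sum_comm]
    refine Finset.sum_congr rfl fun e _ => ?_
    rw [← sum_pauliString_mul_pauliString, Finset.sum_mul]
    exact Finset.sum_congr rfl fun s _ => by ring
  simp_rw [h, ite_and]
  simp

/-- Parseval's identity for the Pauli basis: pair the expansion of `A` with `B`. -/
theorem sum_trace_pauliString_mul {n : ℕ} (A B : Matrix (BitString n) (BitString n) ℂ) :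
    ∑ s : Fin n → Fin 4, (pauliString s * A).trace * (pauliString s * B).trace
      = 2 ^ n * (A * B).trace := by
  have h : ∀ s : Fin n → Fin 4, (pauliString s * A).trace * (pauliString s * B).trace
      = ∑ a, ∑ b, (pauliString s * A).trace * pauliString s a b * B b a := by
    intro s
    simp only [Matrix.trace, Matrix.diag_apply, Matrix.mul_apply, Finset.mul_sum, mul_assoc]
  simp_rw [h]
  rw [Finset.sum_comm]
  simp only [Matrix.trace, Matrix.diag_apply, Matrix.mul_apply, Finset.mul_sum]
  refine Finset.sum_congr rfl fun a _ => ?_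
  rw [Finset.sum_comm]
  refine Finset.sum_congr rfl fun b _ => ?_
  have := sum_trace_pauliString_mul_apply A a b
  simp only [Matrix.trace, Matrix.diag_apply, Matrix.mul_apply] at this
  rw [← Finset.sum_mul, this, mul_assoc]

theorem ofReal_re_trace_pauliString_mul {n : ℕ} {A : Matrix (BitString n) (BitString n) ℂ}
    (hA : A.IsHermitian) (s : Fin n → Fin 4) :
    (((pauliString s * A).trace.re : ℝ) : ℂ) = (pauliString s * A).trace := by
  rw [← Complex.conj_eq_iff_re, starRingEnd_apply, ← Matrix.trace_conjTranspose,
    Matrix.conjTranspose_mul, pauliString_conjTranspose, hA.eq, Matrix.trace_mul_comm]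

theorem sum_re_trace_pauliString_mul_sq {n : ℕ} {A : Matrix (BitString n) (BitString n) ℂ}
    (hA : A.IsHermitian) :
    ∑ s : Fin n → Fin 4, (pauliString s * A).trace.re ^ 2 = 2 ^ n * (A * A).trace.re := by
  have h := congrArg Complex.re (sum_trace_pauliString_mul A A)
  rw [show (2 : ℂ) ^ n = ((2 ^ n : ℝ) : ℂ) by push_cast; rfl, Complex.re_ofReal_mul] at h
  rw [← h, Complex.re_sum]
  refine Finset.sum_congr rfl fun s _ => ?_
  rw [← ofReal_re_trace_pauliString_mul hA, ← Complex.ofReal_mul, Complex.ofReal_re,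
    Complex.ofReal_re, sq]

/-- Nonnegativity of the 2×2 principal minors gives `A i j * A j i ≤ A i i * A j j`; sum over `i`
and `j`. For a state this bounds the purity by `1`. -/
theorem trace_mul_self_re_le {ι : Type*} [Fintype ι] {A : Matrix ι ι ℂ} (hA : A.PosSemidef) :
    (A * A).trace.re ≤ A.trace.re ^ 2 := by
  have h2 : ∀ i j, 0 ≤ A i i * A j j - A i j * A j i := by
    intro i j
    have := (hA.submatrix ![i, j]).det_nonneg
    rwa [Matrix.det_fin_two] at this
  have him : A.trace.im = 0 := (Complex.le_def.mp hA.trace_nonneg).2.symm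
  have h3 : (A * A).trace ≤ A.trace * A.trace := by
    simp only [Matrix.trace, Matrix.diag_apply, Matrix.mul_apply, Finset.sum_mul_sum]
    exact Finset.sum_le_sum fun i _ => Finset.sum_le_sum fun j _ => sub_nonneg.mp (h2 i j)
  have := (Complex.le_def.mp h3).1
  rw [Complex.mul_re, him] at this
  linarith

/-! ### Commutation signs of Pauli strings -/

/-- The sign `±1` with which two single-qubit Pauli matrices commute. -/
def pauliSign (a b : Fin 4) : ℤˣ := if a = 0 ∨ b = 0 ∨ a = b then 1 else -1

/-- The sign `±1` with which two Pauli strings commute. -/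
def pauliStringSign {n : ℕ} (s t : Fin n → Fin 4) : ℤˣ := ∏ i, pauliSign (s i) (t i)

theorem pauli_mul_comm (a b : Fin 4) :
    pauli a * pauli b = ((pauliSign a b : ℤ) : ℂ) • (pauli b * pauli a) := by
  fin_cases a <;> fin_cases b <;> simp [pauli, pauliSign]

theorem pauliString_mul_apply {n : ℕ} (s t : Fin n → Fin 4) (x y : BitString n) :
    (pauliString s * pauliString t) x y = ∏ i, (pauli (s i) * pauli (t i)) (x i) (y i) := by
  simp only [pauliString, Matrix.mul_apply, Matrix.of_apply, ← Finset.prod_mul_distrib]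
  rw [← Fintype.prod_sum fun i z => pauli (s i) (x i) z * pauli (t i) z (y i)]

theorem pauliString_mul_comm {n : ℕ} (s t : Fin n → Fin 4) :
    pauliString s * pauliString t
      = ((pauliStringSign s t : ℤ) : ℂ) • (pauliString t * pauliString s) := by
  ext x y
  rw [Matrix.smul_apply, pauliString_mul_apply, pauliString_mul_apply]
  simp_rw [pauli_mul_comm (s _) (t _), Matrix.smul_apply, smul_eq_mul, Finset.prod_mul_distrib]
  simp [pauliStringSign, Units.coe_prod]

theorem pauliString_mul_self {n : ℕ} (s : Fin n → Fin 4) : pauliString s * pauliString s = 1 := by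
  have h := Matrix.mem_unitaryGroup_iff.mp (pauliString_mem s)
  rwa [Matrix.star_eq_conjTranspose, pauliString_conjTranspose] at h

/-- A single letter at a site where `s` and `t` differ suffices. Conjugation by `u` then negates the
cross term of `s` and `t`. -/
theorem exists_pauliStringSign_mul_eq_neg_one {n : ℕ} {s t : Fin n → Fin 4} (h : s ≠ t) :
    ∃ u, pauliStringSign u s * pauliStringSign u t = -1 := by
  obtain ⟨i, hi⟩ := Function.ne_iff.mp h
  have key : ∀ b c : Fin 4, b ≠ c → ∃ a, pauliSign a b * pauliSign a c = -1 := by decide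
  obtain ⟨a, ha⟩ := key _ _ hi
  refine ⟨fun j => if j = i then a else 0, ?_⟩
  rw [pauliStringSign, pauliStringSign, ← Finset.prod_mul_distrib, Finset.prod_eq_single i]
  · simpa using ha
  · intro j _ hj
    simp [hj, pauliSign]
  · simp

/-- If some site carries a nonidentity letter of both strings, one letter there works. Otherwise the
supports are disjoint, and one letter is placed on each. This links any two nonidentity strings by
two anticommuting steps. -/
theorem exists_pauliStringSign_eq_neg_one {n : ℕ} {s t : Fin n → Fin 4} (hs : s ≠ 0)
    (ht : t ≠ 0) : ∃ u, pauliStringSign s u = -1 ∧ pauliStringSign u t = -1 := by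
  obtain ⟨i, hi⟩ := Function.ne_iff.mp hs
  obtain ⟨j, hj⟩ := Function.ne_iff.mp ht
  have key : ∀ b c : Fin 4, b ≠ 0 → c ≠ 0 → ∃ a, pauliSign b a = -1 ∧ pauliSign a c = -1 := by
    decide
  have single : ∀ k, s k ≠ 0 → t k ≠ 0 →
      ∃ u, pauliStringSign s u = -1 ∧ pauliStringSign u t = -1 := by
    intro k hsk htk
    obtain ⟨a, ha⟩ := key _ _ hsk htk
    refine ⟨fun j => if j = k then a else 0, ?_, ?_⟩
    · rw [pauliStringSign, Finset.prod_eq_single k]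
      · simpa using ha.1
      · intro j _ hj
        simp [hj, pauliSign]
      · simp
    · rw [pauliStringSign, Finset.prod_eq_single k]
      · simpa using ha.2
      · intro j _ hj
        simp [hj, pauliSign]
      · simp
  by_cases hti : t i = 0
  swap
  · exact single i hi hti
  by_cases hsj : s j = 0
  swap
  · exact single j hsj hj
  obtain ⟨a, ha, -⟩ := key _ _ hi hi
  obtain ⟨b, -, hb⟩ := key _ _ hj hj
  have hij : i ≠ j := by
    rintro rfl
    exact hj hti
  refine ⟨fun k => if k = i then a else if k = j then b else 0, ?_, ?_⟩
  · rw [pauliStringSign, Finset.prod_eq_single i]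
    · simpa using ha
    · intro k _ hk
      by_cases hkj : k = j
      · subst hkj
        simp [pauliSign, hsj]
      · simp [hk, hkj, pauliSign]
    · simp
  · rw [pauliStringSign, Finset.prod_eq_single j]
    · simpa [hij.symm] using hb
    · intro k _ hk
      by_cases hki : k = i
      · subst hki
        simp [pauliSign, hti]
      · simp [hk, hki, pauliSign]
    · simp

/-! ### Clifford unitaries acting on Pauli strings -/

theorem exists_pow_I_eq_units (e : ℤˣ) : ∃ k : ℕ, ((e : ℤ) : ℂ) = Complex.I ^ k := by
  rcases Int.units_eq_one_or e with rfl | rfl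
  · exact ⟨0, by simp⟩
  · exact ⟨2, by simp⟩

theorem pauliString_mem_cliffordGroup {n : ℕ} (s : Fin n → Fin 4) :
    (⟨pauliString s, pauliString_mem s⟩ : NQubitUnitary n) ∈ cliffordGroup n :=
  Subgroup.le_normalizer ⟨0, s, by simp⟩

theorem pauliString_conj {n : ℕ} (u s : Fin n → Fin 4) :
    pauliString u * pauliString s * (pauliString u)ᴴ
      = ((pauliStringSign u s : ℤ) : ℂ) • pauliString s := by
  rw [pauliString_conjTranspose, pauliString_mul_comm, smul_mul_assoc, mul_assoc,
    pauliString_mul_self, mul_one]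

/-- A Clifford unitary that exchanges two anticommuting Pauli strings. -/
theorem exists_clifford_conj_eq_of_anticommute {n : ℕ} {s t : Fin n → Fin 4}
    (h : pauliStringSign s t = -1) :
    ∃ V : cliffordGroup n, (V.1 : Matrix (BitString n) (BitString n) ℂ) * pauliString s *
      (V.1 : Matrix (BitString n) (BitString n) ℂ)ᴴ = pauliString t := by
  set P := pauliString s with hP
  set Q := pauliString t with hQ
  have hPQ : P * Q = -(Q * P) := by
    rw [hP, hQ, pauliString_mul_comm, h]
    simp
  have hPP : P * P = 1 := pauliString_mul_self s
  have hQQ : Q * Q = 1 := pauliString_mul_self t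
  -- The unitary is `(P + Q) / √2`. Because `P` and `Q` anticommute it is a Hermitian involution, a
  -- Hadamard-like reflection swapping `P` and `Q`.
  obtain ⟨c, hc, hcs⟩ : ∃ c : ℂ, c * c = 1 / 2 ∧ star c = c := by
    refine ⟨((Real.sqrt (1 / 2) : ℝ) : ℂ), ?_, Complex.conj_ofReal _⟩
    rw [← Complex.ofReal_mul, Real.mul_self_sqrt (by norm_num)]
    norm_num
  have hVh : (c • (P + Q))ᴴ = c • (P + Q) := by
    rw [Matrix.conjTranspose_smul, hcs, Matrix.conjTranspose_add, hP, hQ,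
      pauliString_conjTranspose, pauliString_conjTranspose]
  have conj : ∀ A, c • (P + Q) * A * (c • (P + Q))
      = (1 / 2 : ℂ) • (P * A * P + Q * A * Q + P * A * Q + Q * A * P) := by
    intro A
    rw [smul_mul_assoc, smul_mul_smul_comm, hc]
    congr 1
    noncomm_ring
  have hVV : c • (P + Q) * (c • (P + Q)) = 1 := by
    have := conj 1
    simp only [mul_one] at this
    rw [this, hPP, hQQ, hPQ, neg_add_cancel_right, ← two_smul ℂ, smul_smul]
    norm_num
  let V : NQubitUnitary n := ⟨c • (P + Q), by
    rw [Matrix.mem_unitaryGroup_iff, Matrix.star_eq_conjTranspose, hVh, hVV]⟩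
  have hVinv : V⁻¹ = V := inv_eq_of_mul_eq_one_left (Subtype.ext hVV)
  have hmem : ∀ W ∈ pauliGroup n, V * W * V⁻¹ ∈ pauliGroup n := by
    rintro W ⟨k, u, hW⟩
    have hcoe : ((V * W * V⁻¹ : NQubitUnitary n) : Matrix (BitString n) (BitString n) ℂ)
        = Complex.I ^ k • (c • (P + Q) * pauliString u * (c • (P + Q))) := by
      rw [hVinv, Submonoid.coe_mul, Submonoid.coe_mul, hW, Matrix.mul_smul _ (Complex.I ^ k),
        Matrix.smul_mul (Complex.I ^ k)]
    have hPu : P * pauliString u = ((pauliStringSign s u : ℤ) : ℂ) • (pauliString u * P) :=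
      pauliString_mul_comm s u
    have hQu : Q * pauliString u = ((pauliStringSign t u : ℤ) : ℂ) • (pauliString u * Q) :=
      pauliString_mul_comm t u
    obtain ⟨l, hl⟩ := exists_pow_I_eq_units (pauliStringSign s u)
    have hconj := conj (pauliString u)
    rw [hPu, hQu] at hconj
    simp only [smul_mul_assoc (((_ : ℤˣ) : ℤ) : ℂ), mul_assoc (pauliString u), hPP, hQQ,
      mul_one] at hconj
    -- With equal signs the mixed terms cancel by anticommutation, leaving `±pauliString u`. With
    -- opposite signs the unmixed terms cancel and the mixed ones combine to `±pauliString u * (P *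
    -- Q)`, again a Pauli string up to a phase.
    by_cases hst : pauliStringSign t u = pauliStringSign s u
    · refine ⟨k + l, u, ?_⟩
      rw [hcoe, hconj, hst, hPQ, pow_add, ← hl, mul_smul]
      congr 1
      simp only [mul_neg, smul_neg, neg_add_cancel_right, ← two_smul ℂ (_ • pauliString u),
        smul_smul]
      congr 1
      ring
    · have hts : pauliStringSign t u = -pauliStringSign s u := by
        rcases Int.units_eq_one_or (pauliStringSign t u) with h1 | h1 <;>
          rcases Int.units_eq_one_or (pauliStringSign s u) with h2 | h2 <;> simp_all
      obtain ⟨m, v, hm⟩ := pauliString_mul s t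
      obtain ⟨m', w, hm'⟩ := pauliString_mul u v
      refine ⟨k + l + m + m', w, ?_⟩
      have hQP : Q * P = -(P * Q) := by rw [hPQ, neg_neg]
      rw [hcoe, hconj, hts, hQP, pow_add, pow_add, pow_add, ← hl, mul_smul, mul_smul, mul_smul, ← hm',
        ← Matrix.mul_smul _ (Complex.I ^ m), ← hm]
      congr 1
      push_cast
      simp only [mul_neg, smul_neg, neg_smul, neg_neg, add_neg_cancel, zero_add]
      rw [← two_smul ℂ, smul_smul]
      norm_num
      rfl
  have hV : V ∈ cliffordGroup n := by
    rw [Subgroup.mem_normalizer_iff]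
    intro W
    -- The converse inclusion follows by conjugating once more, as `V` is an involution.
    refine ⟨hmem W, fun hW => ?_⟩
    have := hmem _ hW
    have hVV' : V * V = 1 := Subtype.ext hVV
    rw [hVinv] at this
    rwa [show V * (V * W * V) * V = V * V * W * (V * V) by group, hVV', one_mul, mul_one] at this
  refine ⟨⟨V, hV⟩, ?_⟩
  change c • (P + Q) * P * (c • (P + Q))ᴴ = Q
  have h1 : Q * P * Q = -P := by
    rw [mul_assoc, hPQ, mul_neg, ← mul_assoc, hQQ, one_mul]
  rw [hVh, conj, h1, hPP, mul_assoc Q P P, hPP, one_mul, one_mul, mul_one, add_neg_cancel,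
    zero_add, ← two_smul ℂ, smul_smul]
  norm_num

/-- Makes the quotient a group, so that its uniform distribution is invariant under translation. -/
instance globalPhases_normal (n : ℕ) :
    ((globalPhases n).subgroupOf (cliffordGroup n)).Normal := by
  have : (globalPhases n).Normal := by
    refine ⟨fun U ⟨c, hU⟩ V => ⟨c, ?_⟩⟩
    have h : ((V * V⁻¹ : NQubitUnitary n) : Matrix (BitString n) (BitString n) ℂ) = 1 := by
      rw [mul_inv_cancel]; rfl
    rw [Submonoid.coe_mul] at h
    rw [Submonoid.coe_mul, Submonoid.coe_mul, hU, mul_smul_comm, smul_mul_assoc, mul_one, h]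
  infer_instance

/-! ### Outcome probabilities as linear functionals of the operator -/

section outcomeProb

variable {n : ℕ} (x : BitString n)

theorem outcomeProb_mk (A : Matrix (BitString n) (BitString n) ℂ) (U : cliffordGroup n) :
    outcomeProb A x (QuotientGroup.mk U)
      = (((U.1 : Matrix (BitString n) (BitString n) ℂ) * A *
          (U.1 : Matrix (BitString n) (BitString n) ℂ)ᴴ) x x).re := by
  exact congrArg Complex.re (trace_mul_basisProjector _ x)

theorem outcomeProb_mul_mk (A : Matrix (BitString n) (BitString n) ℂ) (V : cliffordGroup n)
    (q : CliffordUnitary n) :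
    outcomeProb A x (q * QuotientGroup.mk V)
      = outcomeProb ((V.1 : Matrix (BitString n) (BitString n) ℂ) * A *
          (V.1 : Matrix (BitString n) (BitString n) ℂ)ᴴ) x q := by
  induction q using QuotientGroup.induction_on with
  | H U =>
    rw [← QuotientGroup.mk_mul, outcomeProb_mk, outcomeProb_mk, Subgroup.coe_mul,
      Submonoid.coe_mul, Matrix.conjTranspose_mul]
    simp only [mul_assoc]

theorem outcomeProb_smul (r : ℝ) (A : Matrix (BitString n) (BitString n) ℂ)
    (q : CliffordUnitary n) : outcomeProb ((r : ℂ) • A) x q = r * outcomeProb A x q := by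
  induction q using QuotientGroup.induction_on with
  | H U =>
    rw [outcomeProb_mk, outcomeProb_mk, mul_smul_comm, smul_mul_assoc, Matrix.smul_apply,
      smul_eq_mul, Complex.re_ofReal_mul]

theorem outcomeProb_sum {ι : Type*} (I : Finset ι)
    (A : ι → Matrix (BitString n) (BitString n) ℂ) (q : CliffordUnitary n) :
    outcomeProb (∑ i ∈ I, A i) x q = ∑ i ∈ I, outcomeProb (A i) x q := by
  induction q using QuotientGroup.induction_on with
  | H U =>
    simp only [outcomeProb_mk]
    rw [Matrix.mul_sum, Matrix.sum_mul, Matrix.sum_apply, Complex.re_sum]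

theorem outcomeProb_pauliString_zero (q : CliffordUnitary n) :
    outcomeProb (pauliString (0 : Fin n → Fin 4)) x q = 1 := by
  induction q using QuotientGroup.induction_on with
  | H U =>
    have h := Matrix.mem_unitaryGroup_iff.mp U.1.2
    rw [outcomeProb_mk, show pauliString (0 : Fin n → Fin 4) = 1 from pauliString_zero, mul_one,
      ← Matrix.star_eq_conjTranspose, h]
    simp

theorem two_pow_mul_outcomeProb {A : Matrix (BitString n) (BitString n) ℂ} (hA : A.IsHermitian)
    (q : CliffordUnitary n) :
    2 ^ n * outcomeProb A x q = ∑ s : Fin n → Fin 4,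
      (pauliString s * A).trace.re * outcomeProb (pauliString s) x q := by
  simp_rw [← outcomeProb_smul]
  rw [← outcomeProb_sum]
  congr 1
  ext a b
  rw [Matrix.smul_apply, Matrix.sum_apply, smul_eq_mul]
  push_cast
  rw [← sum_trace_pauliString_mul_apply]
  refine Finset.sum_congr rfl fun s _ => ?_
  rw [Matrix.smul_apply, smul_eq_mul, ofReal_re_trace_pauliString_mul hA]

/-- Parseval applied to the rank-one projector `U† |x⟩⟨x| U`, whose Pauli coefficients are the
summands; it holds for each `U` without averaging. -/
theorem sum_outcomeProb_pauliString_sq (q : CliffordUnitary n) :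
    ∑ s : Fin n → Fin 4, outcomeProb (pauliString s) x q ^ 2 = 2 ^ n := by
  induction q using QuotientGroup.induction_on with
  | H U =>
    set M := (U.1 : Matrix (BitString n) (BitString n) ℂ) with hM
    have hU : M * Mᴴ = 1 := Matrix.mem_unitaryGroup_iff.mp U.1.2
    set E := Matrix.single x x (1 : ℂ) with hE
    have hEE : E * E = E := by simp [hE]
    have hAA : (Mᴴ * E * M) * (Mᴴ * E * M) = Mᴴ * E * M := by
      rw [show (Mᴴ * E * M) * (Mᴴ * E * M) = Mᴴ * (E * (M * Mᴴ) * E) * M by noncomm_ring, hU,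
        mul_one, hEE]
    have hA : (Mᴴ * E * M).IsHermitian := by
      have hE' : E.IsHermitian := by
        rw [Matrix.IsHermitian, hE, Matrix.conjTranspose_single, star_one]
      exact Matrix.isHermitian_conjTranspose_mul_mul M hE'
    have htr : (Mᴴ * E * M).trace = 1 := by
      rw [Matrix.trace_mul_comm, ← mul_assoc, hU, one_mul, hE, Matrix.trace_single_eq_same]
    have h := sum_re_trace_pauliString_mul_sq hA
    rw [hAA, htr, Complex.one_re, mul_one] at h
    rw [← h]
    refine Finset.sum_congr rfl fun s _ => ?_
    have : (pauliString s * (Mᴴ * E * M)).trace = (M * pauliString s * Mᴴ) x x := by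
      rw [Matrix.trace_mul_comm, show Mᴴ * E * M * pauliString s = Mᴴ * (E * (M * pauliString s))
        by noncomm_ring, Matrix.trace_mul_comm, mul_assoc, Matrix.trace_mul_comm, hE]
      rw [Matrix.trace_mul_single]
      simp
    rw [outcomeProb_mk, this]

end outcomeProb

/-! ### First and second moments over the Clifford group -/

section moments

variable {n : ℕ} (x : BitString n) [Fintype (CliffordUnitary n)]

/-- Right translation by the class of `V` permutes the group. The functional `F` is arbitrary so
that the invariance serves both products and squares. -/
theorem sum_outcomeProb_conj (V : cliffordGroup n)
    (F : (Matrix (BitString n) (BitString n) ℂ → ℝ) → ℝ) :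
    ∑ q, F (fun A => outcomeProb ((V.1 : Matrix (BitString n) (BitString n) ℂ) * A *
        (V.1 : Matrix (BitString n) (BitString n) ℂ)ᴴ) x q)
      = ∑ q, F fun A => outcomeProb A x q := by
  simp_rw [← outcomeProb_mul_mk]
  exact Equiv.sum_comp (Equiv.mulRight (QuotientGroup.mk V : CliffordUnitary n))
    fun q => F fun A => outcomeProb A x q

theorem sum_outcomeProb_pauliString_mul_of_ne {s t : Fin n → Fin 4} (h : s ≠ t) :
    ∑ q : CliffordUnitary n,
      outcomeProb (pauliString s) x q * outcomeProb (pauliString t) x q = 0 := by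
  obtain ⟨u, hu⟩ := exists_pauliStringSign_mul_eq_neg_one h
  have hc := sum_outcomeProb_conj x ⟨_, pauliString_mem_cliffordGroup u⟩
    fun f => f (pauliString s) * f (pauliString t)
  simp only [pauliString_conj] at hc
  have hcast : ∀ e : ℤˣ, ((e : ℤ) : ℂ) = (((e : ℤ) : ℝ) : ℂ) := fun e => by push_cast; rfl
  simp only [hcast, outcomeProb_smul] at hc
  simp_rw [mul_mul_mul_comm _ (outcomeProb (pauliString s) x _)] at hc
  have hu' : (((pauliStringSign u s : ℤˣ) : ℤ) : ℝ) * (((pauliStringSign u t : ℤˣ) : ℤ) : ℝ)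
      = -1 := by
    rw [← Int.cast_mul, ← Units.val_mul, hu]
    simp
  rw [hu', ← Finset.mul_sum] at hc
  linarith

theorem sum_outcomeProb_pauliString_sq_eq {s t : Fin n → Fin 4} (hs : s ≠ 0) (ht : t ≠ 0) :
    ∑ q : CliffordUnitary n, outcomeProb (pauliString s) x q ^ 2
      = ∑ q : CliffordUnitary n, outcomeProb (pauliString t) x q ^ 2 := by
  have key : ∀ s t : Fin n → Fin 4, pauliStringSign s t = -1 →
      ∑ q : CliffordUnitary n, outcomeProb (pauliString s) x q ^ 2
        = ∑ q : CliffordUnitary n, outcomeProb (pauliString t) x q ^ 2 := by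
    intro s t h
    obtain ⟨V, hV⟩ := exists_clifford_conj_eq_of_anticommute h
    have hc := sum_outcomeProb_conj x V fun f => f (pauliString s) ^ 2
    simp only [hV] at hc
    exact hc.symm
  obtain ⟨u, hsu, hut⟩ := exists_pauliStringSign_eq_neg_one hs ht
  exact (key s u hsu).trans (key u t hut)

/-- Count the sum over all strings and all `q` in two ways: it is `2 ^ n` for each `q`, while the `4
^ n - 1` nonidentity strings contribute equally. -/
theorem sum_clifford_outcomeProb_pauliString_sq {s : Fin n → Fin 4} (hs : s ≠ 0) :
    ∑ q : CliffordUnitary n, outcomeProb (pauliString s) x q ^ 2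
      = Fintype.card (CliffordUnitary n) / (2 ^ n + 1) := by
  have hn : n ≠ 0 := by
    rintro rfl
    exact hs (Subsingleton.elim _ _)
  have hd : (1 : ℝ) < 2 ^ n := one_lt_pow₀ (by norm_num) hn
  have h1 : ∑ t : Fin n → Fin 4, ∑ q : CliffordUnitary n, outcomeProb (pauliString t) x q ^ 2
      = Fintype.card (CliffordUnitary n) * 2 ^ n := by
    rw [Finset.sum_comm]
    simp [sum_outcomeProb_pauliString_sq]
  rw [← Finset.add_sum_erase _ _ (Finset.mem_univ 0), Finset.sum_congr rfl fun t ht =>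
    sum_outcomeProb_pauliString_sq_eq x (Finset.ne_of_mem_erase ht) hs, Finset.sum_const,
    Finset.card_erase_of_mem (Finset.mem_univ _), nsmul_eq_mul, Nat.cast_pred (by simp)] at h1
  simp only [outcomeProb_pauliString_zero, Finset.card_univ, Fintype.card_pi, Fintype.card_fin,
    Finset.prod_const, one_pow, Finset.sum_const, nsmul_eq_mul, mul_one] at h1
  push_cast at h1
  rw [show (4 : ℝ) ^ n = 2 ^ n * 2 ^ n by rw [← mul_pow]; norm_num] at h1
  rw [eq_div_iff (by positivity)]
  -- This factor of `4 ^ n - 1` can be cancelled because a nonidentity string exists only for `n ≥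
  -- 1`.
  have h2 : (2 : ℝ) ^ n - 1 ≠ 0 := by linarith
  apply mul_left_cancel₀ h2
  linear_combination h1

/-- Orthogonality to the identity string, whose outcome value is constantly `1`, removes every other
Pauli coefficient. -/
theorem sum_outcomeProb {ρ : Matrix (BitString n) (BitString n) ℂ} (hρ : IsState ρ) :
    2 ^ n * ∑ q, outcomeProb ρ x q = Fintype.card (CliffordUnitary n) := by
  rw [Finset.mul_sum]
  simp_rw [two_pow_mul_outcomeProb x hρ.1.1]
  rw [Finset.sum_comm, Finset.sum_eq_single 0]
  · simp_rw [outcomeProb_pauliString_zero]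
    rw [show pauliString (0 : Fin n → Fin 4) = 1 from pauliString_zero, one_mul, hρ.2]
    simp
  · intro s _ hs
    have := sum_outcomeProb_pauliString_mul_of_ne x hs
    simp only [outcomeProb_pauliString_zero, mul_one] at this
    rw [← Finset.mul_sum, this, mul_zero]
  · simp

/-- The second moment of the outcome probability, as for a unitary 2-design. -/
theorem sum_outcomeProb_sq_le {ρ : Matrix (BitString n) (BitString n) ℂ} (hρ : IsState ρ) :
    (2 ^ n) ^ 2 * ∑ q, outcomeProb ρ x q ^ 2
      ≤ Fintype.card (CliffordUnitary n) * (2 * 2 ^ n / (2 ^ n + 1)) := by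
  set N : ℝ := (Fintype.card (CliffordUnitary n) : ℝ)
  set r : (Fin n → Fin 4) → ℝ := fun s => (pauliString s * ρ).trace.re with hr
  have hr0 : r 0 = 1 := by
    simp only [hr]
    rw [show pauliString (0 : Fin n → Fin 4) = 1 from pauliString_zero, one_mul, hρ.2,
      Complex.one_re]
  have hsum : ∑ s, r s ^ 2 ≤ 2 ^ n := by
    rw [sum_re_trace_pauliString_mul_sq hρ.1.1]
    have := trace_mul_self_re_le hρ.1
    rw [hρ.2, Complex.one_re, one_pow] at this
    exact mul_le_of_le_one_right (by positivity) this
  -- Squaring the Pauli expansion gives a double sum in which only the diagonal terms survive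
  -- averaging.
  have hsq : (2 ^ n) ^ 2 * ∑ q, outcomeProb ρ x q ^ 2
      = ∑ s, r s ^ 2 * ∑ q : CliffordUnitary n, outcomeProb (pauliString s) x q ^ 2 := by
    have hq : ∀ q, (2 ^ n) ^ 2 * outcomeProb ρ x q ^ 2 = ∑ s, ∑ t,
        r s * r t * (outcomeProb (pauliString s) x q * outcomeProb (pauliString t) x q) := by
      intro q
      rw [← mul_pow, two_pow_mul_outcomeProb x hρ.1.1, sq, Finset.sum_mul_sum]
      exact Finset.sum_congr rfl fun s _ => Finset.sum_congr rfl fun t _ => mul_mul_mul_comm ..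
    rw [Finset.mul_sum, Finset.sum_congr rfl fun q _ => hq q, Finset.sum_comm]
    refine Finset.sum_congr rfl fun s _ => ?_
    rw [Finset.sum_comm, Finset.sum_eq_single s]
    · simp_rw [sq, Finset.mul_sum]
    · intro t _ ht
      rw [← Finset.mul_sum, sum_outcomeProb_pauliString_mul_of_ne x ht.symm, mul_zero]
    · simp
  rw [← Finset.add_sum_erase _ _ (Finset.mem_univ 0)] at hsum
  rw [← Finset.add_sum_erase (M := ℝ) _ _ (Finset.mem_univ (0 : Fin n → Fin 4))] at hsq
  have hrest : ∑ s ∈ Finset.univ.erase 0,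
      r s ^ 2 * ∑ q : CliffordUnitary n, outcomeProb (pauliString s) x q ^ 2
        = (∑ s ∈ Finset.univ.erase 0, r s ^ 2) * (N / (2 ^ n + 1)) := by
    rw [Finset.sum_mul]
    refine Finset.sum_congr rfl fun s hs => ?_
    rw [sum_clifford_outcomeProb_pauliString_sq x (Finset.ne_of_mem_erase hs)]
  rw [hsq, hrest]
  simp only [outcomeProb_pauliString_zero, hr0, one_pow, one_mul, Finset.sum_const,
    Finset.card_univ, nsmul_eq_mul, mul_one] at hsum ⊢
  have hN : 0 ≤ N / (2 ^ n + 1) := by positivity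
  have hd : (0 : ℝ) < 2 ^ n + 1 := by positivity
  calc N + (∑ s ∈ Finset.univ.erase 0, r s ^ 2) * (N / (2 ^ n + 1))
      ≤ N + (2 ^ n - 1) * (N / (2 ^ n + 1)) := by gcongr; linarith
    _ = N * (2 * 2 ^ n / (2 ^ n + 1)) := by field_simp; ring

end moments

/-! ### Paley–Zygmund and the conclusion -/

/-- The Paley–Zygmund inequality for the uniform distribution on a finite type. -/
theorem paley_zygmund_sum {Ω : Type*} [Fintype Ω] (f : Ω → ℝ) {a : ℝ} (ha : 0 ≤ a)
    (hle : Fintype.card Ω * a ≤ ∑ q, f q) :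
    (∑ q, f q - Fintype.card Ω * a) ^ 2 ≤ {q | a ≤ f q}.ncard * ∑ q, f q ^ 2 := by
  classical
  set S : Finset Ω := {q | a ≤ f q}
  have hS : {q | a ≤ f q}.ncard = S.card := by
    rw [← Set.ncard_coe_finset]
    simp [S]
  -- Off `S` the term `f q - a` is negative, and on `S` dropping `a ≥ 0` only increases it.
  -- Cauchy–Schwarz on `S` then finishes.
  have h1 : ∑ q, f q - Fintype.card Ω * a ≤ ∑ q ∈ S, f q := by
    rw [← nsmul_eq_mul, ← Finset.card_univ, ← Finset.sum_const, ← Finset.sum_sub_distrib,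
      Finset.sum_filter]
    refine Finset.sum_le_sum fun q _ => ?_
    split_ifs <;> linarith
  calc (∑ q, f q - Fintype.card Ω * a) ^ 2 ≤ (∑ q ∈ S, f q) ^ 2 :=
        pow_le_pow_left₀ (sub_nonneg.mpr hle) h1 2
    _ ≤ S.card * ∑ q ∈ S, f q ^ 2 := sq_sum_le_card_mul_sum_sq
    _ ≤ {q | a ≤ f q}.ncard * ∑ q, f q ^ 2 := by
        rw [hS]
        gcongr
        exact S.subset_univ

end QClifford

theorem mainTheorem6 (n : ℕ)
    (ρ : Matrix (QClifford.BitString n) (QClifford.BitString n) ℂ) (hρ : QClifford.IsState ρ)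
    (x : QClifford.BitString n) (α : ℝ) (hα : α ∈ Set.Ioo (0 : ℝ) 1) :
    QClifford.uniformProb {U : QClifford.CliffordUnitary n |
        QClifford.outcomeProb ρ x U ≥ α / 2 ^ n} > (1 - α) ^ 2 / 2 := by
  obtain ⟨hα0, hα1⟩ := hα
  have : Fintype (QClifford.CliffordUnitary n) := Fintype.ofFinite _
  have hN : (0 : ℝ) < Fintype.card (QClifford.CliffordUnitary n) := by
    exact_mod_cast Fintype.card_pos
  have hd : (0 : ℝ) < 2 ^ n := by positivity
  have h1 := QClifford.sum_outcomeProb x hρ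
  have h2 := QClifford.sum_outcomeProb_sq_le x hρ
  rw [QClifford.uniformProb, Nat.card_eq_fintype_card]
  simp only [ge_iff_le]
  set N : ℝ := (Fintype.card (QClifford.CliffordUnitary n) : ℝ) with hNdef
  set d : ℝ := 2 ^ n
  set m : ℝ := ({q | α / d ≤ QClifford.outcomeProb ρ x q}.ncard : ℝ)
  have hmean : ∑ q, QClifford.outcomeProb ρ x q = N / d := by
    rw [eq_div_iff hd.ne', mul_comm, h1]
  have h3 := QClifford.paley_zygmund_sum (QClifford.outcomeProb ρ x) (a := α / d) (by positivity)
    (by rw [hmean, ← hNdef, ← mul_div_assoc]; gcongr; nlinarith)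
  rw [hmean, ← hNdef] at h3
  have h4 : (N * (1 - α)) ^ 2 ≤ m * (N * (2 * d / (d + 1))) := by
    calc (N * (1 - α)) ^ 2 = d ^ 2 * (N / d - N * (α / d)) ^ 2 := by field_simp
      _ ≤ d ^ 2 * (m * ∑ q, QClifford.outcomeProb ρ x q ^ 2) := by gcongr
      _ = m * (d ^ 2 * ∑ q, QClifford.outcomeProb ρ x q ^ 2) := by ring
      _ ≤ m * (N * (2 * d / (d + 1))) := by gcongr
  -- The strictness of the final bound comes from here, and survives multiplication by `m` because
  -- `m > 0`.
  have h5 : 2 * d / (d + 1) < 2 := by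
    rw [div_lt_iff₀ (by positivity)]
    linarith
  have hα' : 0 < 1 - α := sub_pos.mpr hα1
  have h6 : N * (1 - α) ^ 2 ≤ m * (2 * d / (d + 1)) := by
    refine le_of_mul_le_mul_left ?_ hN
    linarith
  have hm : 0 < m := by
    have : 0 < m * (2 * d / (d + 1)) := lt_of_lt_of_le (by positivity) h6
    exact pos_of_mul_pos_left this (by positivity)
  rw [gt_iff_lt, div_lt_div_iff₀ two_pos hN]
  nlinarith [mul_lt_mul_of_pos_left h5 hm]
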